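/- A polynomial is called Hurwitz stable if all its complex roots lie in the open left half-plane; a family of polynomials is Hurwitz stable if every member is. For $n\ge 0$ and real numbers $q_i^-\le q_i^+$ ($i=0,\dots,n$), consider the real interval polynomial family $$\Gamma=\Big\{\sum_{i=0}^n q_i s^i \;:\; q_i\in[q_i^-,q_i^+],\ i=0,\dots,n\Big\}$$ and its four Kharitonov polynomials $$\begin{aligned}K_1(s)&=q_0^-+q_1^-s+q_2^+s^2+q_3^+s^3+q_4^-s^4+q_5^-s^5+\cdots,\\ K_2(s)&=q_0^++q_1^+s+q_2^-s^2+q_3^-s^3+q_4^+s^4+q_5^+s^5+\cdots,\\ K_3(s)&=q_0^++q_1^-s+q_2^-s^2+q_3^+s^3+q_4^+s^4+q_5^-s^5+\cdots,\\ K_4(s)&=q_0^-+q_1^+s+q_2^+s^2+q_3^-s^3+q_4^-s^4+q_5^+s^5+\cdots,\end{aligned}$$ where the sign patterns continue with period $4$ and the sums stop at $s^n$. **Theorem 1.** Let $\Gamma_u$ and $\Gamma_v$ be real interval polynomial families, of orders $n_u$ and $n_v$, with Kharitonov polynomials $K_i^u$ and $K_j^v$ ($i,j=1,2,3,4$), let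 $m\ge 0$ and $a_0,\dots,a_m\in\mathbb R$, and put $f(x,y)=\sum_{k=0}^m a_k x^k y^{m-k}$. Suppose that the family $$f(\Gamma_u,\Gamma_v)=\{f(p_u,p_v) : p_u\in\Gamma_u,\ p_v\in\Gamma_v\}$$ has a fixed degree, that is, there is an integer $N\ge 0$ such that all its members are nonzero polynomials of degree exactly $N$. Then $f(\Gamma_u,\Gamma_v)$ is Hurwitz stable if and only if the $16$ polynomials $f(K_i^u,K_j^v)$, $i,j=1,2,3,4$, are Hurwitz stable. -/

import Mathlib

open Polynomial

namespace RobustStability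

/-- A real polynomial is Hurwitz stable if all its complex roots lie in the open left
half-plane. (Every complex number is a root of the zero polynomial, so it is not stable.) -/
def HurwitzStable (p : ℝ[X]) : Prop :=
  ∀ z : ℂ, aeval z p = 0 → z.re < 0

/-- A family of polynomials is Hurwitz stable if all its members are. -/
def FamilyHurwitzStable (P : Set ℝ[X]) : Prop :=
  ∀ p ∈ P, HurwitzStable p

/-- A family has fixed degree if all its members are nonzero polynomials of one common degree. -/
def HasFixedDegree (P : Set ℝ[X]) : Prop :=
  ∃ N : ℕ, ∀ p ∈ P, p.degree = N

/-- The real interval polynomial family of order `n` with coefficient bounds `lo i ≤ q i ≤ hi i`,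
`i = 0, …, n`. Only the values of `lo` and `hi` at `0, …, n` matter. -/
def intervalFamily (n : ℕ) (lo hi : ℕ → ℝ) : Set ℝ[X] :=
  {p | ∃ q : ℕ → ℝ, (∀ i ≤ n, q i ∈ Set.Icc (lo i) (hi i)) ∧
    p = ∑ i ∈ Finset.range (n + 1), C (q i) * X ^ i}

/-- The residues mod 4 of the exponents at which the Kharitonov polynomials
`K₁, K₂, K₃, K₄` (numbered `0, 1, 2, 3`) take the upper coefficient bound. The sign patterns are
`- - + +`, `+ + - -`, `+ - - +`, `- + + -`. -/
def upperResidues : Fin 4 → Finset ℕ :=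
  ![{2, 3}, {0, 1}, {0, 3}, {1, 2}]

/-- The four Kharitonov polynomials of `intervalFamily n lo hi`. -/
noncomputable def kharitonov (n : ℕ) (lo hi : ℕ → ℝ) (i : Fin 4) : ℝ[X] :=
  ∑ k ∈ Finset.range (n + 1), C (if k % 4 ∈ upperResidues i then hi k else lo k) * X ^ k

/-- The form `a_m x^m + a_{m-1} x^{m-1} y + ⋯ + a_1 x y^{m-1} + a_0 y^m` evaluated at two
polynomials. -/
noncomputable def form (m : ℕ) (a : ℕ → ℝ) (x y : ℝ[X]) : ℝ[X] :=
  ∑ k ∈ Finset.range (m + 1), C (a k) * x ^ k * y ^ (m - k)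

/-- The family `{f(p_u, p_v) | p_u ∈ U, p_v ∈ V}`. -/
def imageFamily (f : ℝ[X] → ℝ[X] → ℝ[X]) (U V : Set ℝ[X]) : Set ℝ[X] :=
  {p | ∃ pu ∈ U, ∃ pv ∈ V, p = f pu pv}

end RobustStability

namespace RobustStability

/-! Zero exclusion (`stable_of_path`): at constant degree roots cannot escape to infinity, so
stability persists along a path unless a root meets the imaginary axis. At `iw` with `w ≥ 0`, every
value of an interval family is a value of the parallelogram of its Kharitonov polynomials
(`exists_kharitonovBox_aeval_eq`), and `f(p_u, p_v)(z)` depends only on `p_u(z)` and `p_v(z)`. It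
therefore suffices to pass from the 16 corners to the product of the two parallelograms, whose edge
directions are even or odd polynomials.

This passage is the segment lemma `hurwitzStable_form_of_endpoints`. Over `ℂ` the form splits into
linear factors, and a zero on the segment is a zero of some `g0 + tG`, with `g0` and `g0 + G` stable
and `G` a multiple of an even or odd polynomial. At an imaginary zero, a positive combination of the
logarithmic derivatives of `g0` and `g0 + G` equals that of `G`, which is purely imaginary; but a
nonconstant stable polynomial has one with positive real part. So both ends are constant, the factor
vanishes identically, and so does the form, against the fixed degree. -/

/-! ### Stable complex polynomials and zero exclusion -/

/-- The logarithmic derivative is the sum of `1 / (z - r)` over the roots `r`, and each term has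
positive real part. -/
lemma re_logDeriv_nonneg {g : ℂ[X]} (hg : ∀ w, g.eval w = 0 → w.re < 0) {z : ℂ} (hz : z.re = 0) :
    0 ≤ (g.derivative.eval z / g.eval z).re ∧
      ((g.derivative.eval z / g.eval z).re = 0 → g.natDegree = 0) := by
  have hgz : g.eval z ≠ 0 := fun h => by have := hg z h; linarith
  have hg0 : g ≠ 0 := fun h => hgz (by simp [h])
  have hpos : ∀ r ∈ g.roots, 0 < (1 / (z - r)).re := by
    intro r hr
    have h1 := hg r ((mem_roots hg0).1 hr)
    have h2 : 0 < (z - r).re := by rw [Complex.sub_re]; linarith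
    rw [one_div, Complex.inv_re]
    refine div_pos h2 (Complex.normSq_pos.2 fun h => ?_)
    simp [h] at h2
  have hsum : (g.derivative.eval z / g.eval z).re =
      (g.roots.map fun r => (1 / (z - r)).re).sum := by
    rw [(IsAlgClosed.splits g).eval_derivative_div_eval_of_ne_zero hgz,
      ← Complex.coe_reAddGroupHom, map_multiset_sum, Multiset.map_map]
    rfl
  rw [hsum]
  refine ⟨Multiset.sum_nonneg fun x hx => ?_, fun h => ?_⟩
  · obtain ⟨r, hr, rfl⟩ := Multiset.mem_map.1 hx
    exact (hpos r hr).le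
  · rw [← splits_iff_card_roots.1 (IsAlgClosed.splits g), Multiset.card_eq_zero]
    by_contra hne
    obtain ⟨r, hr⟩ := Multiset.exists_mem_of_ne_zero hne
    have hle := Multiset.single_le_sum (s := g.roots.map fun r => (1 / (z - r)).re)
      (fun x hx => by
        obtain ⟨r, hr, rfl⟩ := Multiset.mem_map.1 hx
        exact (hpos r hr).le) _ (Multiset.mem_map_of_mem _ hr)
    have := hpos r hr
    linarith

/-- Each root `r` satisfies `‖z - r‖ ≥ z.re`. This quantitative form of nonvanishing survives
limits, which makes stability a closed condition. -/
lemma norm_leadingCoeff_mul_pow_le {g : ℂ[X]} (hg : ∀ w, g.eval w = 0 → w.re < 0) {z : ℂ}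
    (hz : 0 ≤ z.re) : ‖g.leadingCoeff‖ * z.re ^ g.natDegree ≤ ‖g.eval z‖ := by
  by_cases hg0 : g = 0
  · simp [hg0]
  rw [(IsAlgClosed.splits g).eval_eq_prod_roots, norm_mul,
    ← splits_iff_card_roots.1 (IsAlgClosed.splits g)]
  refine mul_le_mul_of_nonneg_left ?_ (norm_nonneg _)
  have hroots : ∀ r ∈ g.roots, z.re ≤ ‖z - r‖ := fun r hr => by
    have h1 := hg r ((mem_roots hg0).1 hr)
    have h2 := Complex.re_le_norm (z - r)
    rw [Complex.sub_re] at h2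
    linarith
  generalize g.roots = s at hroots
  induction s using Multiset.induction with
  | empty => simp
  | cons r s ih =>
    rw [Multiset.card_cons, pow_succ', Multiset.map_cons, Multiset.prod_cons, norm_mul]
    exact mul_le_mul (hroots r (Multiset.mem_cons_self r s))
      (ih fun q hq => hroots q (Multiset.mem_cons_of_mem hq)) (pow_nonneg hz _) (norm_nonneg _)

/-- Cauchy's bound with the supremum weakened to a sum, so that it is visibly continuous in the
coefficients. -/
lemma norm_le_sum_of_eval_eq_zero {g : ℂ[X]} {N : ℕ} (hN : g.degree = N) {z : ℂ}
    (hz : g.eval z = 0) : ‖z‖ ≤ (∑ k ∈ Finset.range (N + 1), ‖g.coeff k‖) / ‖g.coeff N‖ + 1 := by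
  have hg0 : g ≠ 0 := fun h => by simp [h] at hN
  have hnat : g.natDegree = N := natDegree_eq_of_degree_eq_some hN
  have h : ‖z‖ ≤ g.cauchyBound := by exact_mod_cast (IsRoot.norm_lt_cauchyBound hg0 hz).le
  refine h.trans ?_
  rw [cauchyBound, leadingCoeff, hnat]
  push_cast
  gcongr
  have h2 : (Finset.range N).sup (‖g.coeff ·‖₊) ≤ ∑ k ∈ Finset.range (N + 1), ‖g.coeff k‖₊ :=
    Finset.sup_le fun k hk => Finset.single_le_sum (f := (‖g.coeff ·‖₊)) (fun _ _ => zero_le)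
      (Finset.mem_range.2 ((Finset.mem_range.1 hk).trans N.lt_succ_self))
  simpa only [NNReal.coe_sum, coe_nnnorm] using NNReal.coe_le_coe.2 h2

/-- Along a path of polynomials of constant degree without roots on the imaginary axis, stability
does not change. -/
lemma stable_of_path {Q : ℝ → ℂ[X]} {N : ℕ} (hc : ∀ n, Continuous fun t => (Q t).coeff n)
    (hdeg : ∀ t ∈ Set.Icc (0 : ℝ) 1, (Q t).degree = N)
    (him : ∀ t ∈ Set.Icc (0 : ℝ) 1, ∀ z : ℂ, z.re = 0 → (Q t).eval z ≠ 0)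
    (h0 : ∀ z, (Q 0).eval z = 0 → z.re < 0) :
    ∀ t ∈ Set.Icc (0 : ℝ) 1, ∀ z, (Q t).eval z = 0 → z.re < 0 := by
  set E : ℝ → ℂ → ℂ := fun t z => ∑ k ∈ Finset.range (N + 1), (Q t).coeff k * z ^ k with hE
  have hnat : ∀ t ∈ Set.Icc (0 : ℝ) 1, (Q t).natDegree = N := fun t ht =>
    natDegree_eq_of_degree_eq_some (hdeg t ht)
  have hEval : ∀ t ∈ Set.Icc (0 : ℝ) 1, ∀ z, (Q t).eval z = E t z := fun t ht z => by
    rw [eval_eq_sum_range, hnat t ht]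
  have hEc : Continuous fun p : ℝ × ℂ => E p.1 p.2 :=
    continuous_finsetSum _ fun k _ => ((hc k).comp continuous_fst).mul (continuous_snd.pow k)
  have hlead : ∀ t ∈ Set.Icc (0 : ℝ) 1, (Q t).coeff N ≠ 0 := fun t ht => by
    rw [← hnat t ht]
    exact leadingCoeff_ne_zero.2 fun h => by simpa [h] using hdeg t ht
  let S : Set (Set.Icc (0 : ℝ) 1) := {t | ∀ z, (Q t).eval z = 0 → z.re < 0}
  have hclosed : IsClosed S := by
    -- The non-strict bound excludes roots with positive real part because the leading coefficient
    -- is nonzero; `him` excludes the axis.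
    have hS : S = ⋂ z : {z : ℂ // 0 < z.re},
        {t : Set.Icc (0 : ℝ) 1 | ‖(Q t).coeff N‖ * z.1.re ^ N ≤ ‖E t z‖} := by
      ext t
      simp only [Set.mem_iInter, Set.mem_ofPred_eq, S]
      constructor
      · intro h z
        have := norm_leadingCoeff_mul_pow_le h z.2.le
        rwa [leadingCoeff, hnat t t.2, hEval t t.2] at this
      · intro h z hz
        by_contra hre
        rcases (not_lt.1 hre).lt_or_eq with hlt | heq
        · have h1 := h ⟨z, hlt⟩
          rw [← hEval t t.2, hz, norm_zero] at h1
          have h2 := mul_pos (norm_pos_iff.2 (hlead t t.2)) (pow_pos hlt N)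
          exact absurd h1 (not_le.2 h2)
        · exact him t t.2 z heq.symm hz
    rw [hS]
    refine isClosed_iInter fun z => isClosed_le ?_ ?_
    · exact (((hc N).comp continuous_subtype_val).norm).mul continuous_const
    · exact (hEc.comp (continuous_subtype_val.prodMk continuous_const)).norm
  have hopen : IsOpen S := by
    obtain ⟨B, hB⟩ : ∃ B : ℝ, ∀ t ∈ Set.Icc (0 : ℝ) 1, ∀ z, (Q t).eval z = 0 → ‖z‖ ≤ B := by
      have hcont : ContinuousOn (fun t => (∑ k ∈ Finset.range (N + 1), ‖(Q t).coeff k‖) /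
          ‖(Q t).coeff N‖ + 1) (Set.Icc (0 : ℝ) 1) :=
        ((continuous_finsetSum _ fun k _ => (hc k).norm).continuousOn.div
          (hc N).norm.continuousOn fun t ht => norm_ne_zero_iff.2 (hlead t ht)).add
          continuousOn_const
      obtain ⟨B, hB⟩ := isCompact_Icc.bddAbove_image hcont
      exact ⟨B, fun t ht z hz => (norm_le_sum_of_eval_eq_zero (hdeg t ht) hz).trans
        (hB (Set.mem_image_of_mem _ ht))⟩
    rw [← isClosed_compl_iff]
    -- The uniform root bound `B` presents the unstable parameters as the projection of a compact
    -- set.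
    have hS : Sᶜ = Prod.fst '' ((Set.univ ×ˢ Metric.closedBall (0 : ℂ) B) ∩
        {p : Set.Icc (0 : ℝ) 1 × ℂ | E p.1 p.2 = 0 ∧ 0 ≤ p.2.re}) := by
      ext t
      simp only [Set.mem_compl_iff, Set.mem_ofPred_eq, S, Set.mem_image, not_forall, not_lt]
      constructor
      · rintro ⟨z, hz, hre⟩
        exact ⟨(t, z), ⟨⟨trivial, by simpa using hB t t.2 z hz⟩, by rwa [← hEval t t.2], hre⟩, rfl⟩
      · rintro ⟨⟨t, z⟩, ⟨-, hz, hre⟩, rfl⟩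
        exact ⟨z, by rw [hEval t t.2]; exact hz, hre⟩
    rw [hS]
    refine (((isCompact_univ.prod (isCompact_closedBall _ _)).inter_right ?_).image
      continuous_fst).isClosed
    exact (isClosed_eq (hEc.comp ((continuous_subtype_val.comp continuous_fst).prodMk
      continuous_snd)) continuous_const).inter
      (isClosed_le continuous_const (Complex.continuous_re.comp continuous_snd))
  have huniv : S = Set.univ :=
    IsClopen.eq_univ ⟨hclosed, hopen⟩ ⟨⟨0, by simp⟩, h0⟩
  intro t ht
  have : (⟨t, ht⟩ : Set.Icc (0 : ℝ) 1) ∈ S := huniv ▸ Set.mem_univ _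
  exact this

/-! ### Binary forms and their linear factors -/

/-- The value at complex numbers `x, y` of the form with real coefficients `a`. -/
noncomputable def formValue (m : ℕ) (a : ℕ → ℝ) (x y : ℂ) : ℂ :=
  ∑ k ∈ Finset.range (m + 1), (a k : ℂ) * x ^ k * y ^ (m - k)

lemma aeval_form (m : ℕ) (a : ℕ → ℝ) (x y : ℝ[X]) (z : ℂ) :
    aeval z (form m a x y) = formValue m a (aeval z x) (aeval z y) := by
  simp [form, formValue]

lemma formValue_mul (m : ℕ) (a : ℕ → ℝ) (c x y : ℂ) :
    formValue m a (c * x) (c * y) = c ^ m * formValue m a x y := by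
  rw [formValue, formValue, Finset.mul_sum]
  refine Finset.sum_congr rfl fun k hk => ?_
  have hk' : k ≤ m := Nat.lt_succ_iff.1 (Finset.mem_range.1 hk)
  rw [mul_pow, mul_pow, ← pow_mul_pow_sub c hk']
  ring

/-- If a nonzero form vanishes at `(x, y)`, then so does one of its linear factors. -/
lemma exists_linear_factor {m : ℕ} {a : ℕ → ℝ} (ha : ∃ k ≤ m, a k ≠ 0) {x y : ℂ}
    (h : formValue m a x y = 0) :
    ∃ b c : ℂ, (b ≠ 0 ∨ c ≠ 0) ∧ formValue m a b c = 0 ∧ c * x = b * y := by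
  by_cases hxy : x ≠ 0 ∨ y ≠ 0
  · exact ⟨x, y, hxy, h, mul_comm _ _⟩
  obtain ⟨rfl, rfl⟩ : x = 0 ∧ y = 0 := by simpa using hxy
  -- At the origin any projective zero of the form will do: `(1, 0)`, where the value is `a m`, or
  -- else a root of the dehomogenized polynomial.
  by_cases ham : a m = 0
  · refine ⟨1, 0, Or.inl one_ne_zero, Finset.sum_eq_zero fun k hk => ?_, by simp⟩
    rcases (Nat.lt_succ_iff.1 (Finset.mem_range.1 hk)).lt_or_eq with hlt | rfl
    · rw [zero_pow (Nat.sub_ne_zero_of_lt hlt), mul_zero]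
    · simp [ham]
  · have hm : m ≠ 0 := by
      rintro rfl
      simp [formValue, ham] at h
    let p : ℂ[X] := ∑ k ∈ Finset.range (m + 1), C (a k : ℂ) * X ^ k
    have hp : p.coeff m ≠ 0 := by simpa [p, finsetSum_coeff, coeff_C_mul, coeff_X_pow] using ham
    obtain ⟨r, hr⟩ := IsAlgClosed.exists_root p fun h0 => by
      have : (m : WithBot ℕ) ≤ 0 := h0 ▸ le_degree_of_ne_zero hp
      exact hm (by simpa using this)
    refine ⟨r, 1, Or.inr one_ne_zero, ?_, by simp⟩
    simpa [formValue, p, IsRoot, eval_finsetSum] using hr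

/-- The linear relation makes `(x, y)` a multiple of `(b, c)`; homogeneity does the rest. -/
lemma formValue_eq_zero_of_linear_factor {m : ℕ} {a : ℕ → ℝ} {b c x y : ℂ}
    (hbc : b ≠ 0 ∨ c ≠ 0) (h : formValue m a b c = 0) (hxy : c * x = b * y) :
    formValue m a x y = 0 := by
  obtain ⟨d, rfl, rfl⟩ : ∃ d, x = d * b ∧ y = d * c := by
    rcases hbc with hb | hc
    · exact ⟨x / b, by field_simp, by field_simp; linear_combination -hxy⟩
    · exact ⟨y / c, by field_simp; linear_combination hxy, by field_simp⟩
  rw [formValue_mul, h, mul_zero]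

lemma exists_coeff_ne_zero_of_form_ne_zero {m : ℕ} {a : ℕ → ℝ} {x y : ℝ[X]}
    (h : form m a x y ≠ 0) : ∃ k ≤ m, a k ≠ 0 := by
  by_contra! hall
  refine h (Finset.sum_eq_zero fun k hk => ?_)
  rw [hall k (Nat.lt_succ_iff.1 (Finset.mem_range.1 hk))]
  simp

/-! ### Forms along segments -/

lemma continuous_coeff_mul {p q : ℝ → ℝ[X]} (hp : ∀ n, Continuous fun t => (p t).coeff n)
    (hq : ∀ n, Continuous fun t => (q t).coeff n) (n : ℕ) :
    Continuous fun t => (p t * q t).coeff n := by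
  simp only [coeff_mul]
  exact continuous_finsetSum _ fun k _ => (hp _).mul (hq _)

lemma continuous_coeff_pow {p : ℝ → ℝ[X]} (hp : ∀ n, Continuous fun t => (p t).coeff n)
    (k n : ℕ) : Continuous fun t => (p t ^ k).coeff n := by
  induction k generalizing n with
  | zero => simpa using continuous_const
  | succ k ih =>
    simp only [pow_succ]
    exact continuous_coeff_mul ih hp n

lemma continuous_coeff_form (m : ℕ) (a : ℕ → ℝ) {x y : ℝ → ℝ[X]}
    (hx : ∀ n, Continuous fun t => (x t).coeff n) (hy : ∀ n, Continuous fun t => (y t).coeff n)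
    (n : ℕ) : Continuous fun t => (form m a (x t) (y t)).coeff n := by
  simp only [form, finsetSum_coeff]
  exact continuous_finsetSum _ fun k _ => continuous_coeff_mul
    (continuous_coeff_mul (fun _ => continuous_const) (continuous_coeff_pow hx k))
    (continuous_coeff_pow hy _) n

/-- A real version of `stable_of_path` for forms along a segment. -/
lemma hurwitzStable_form_segment {m : ℕ} {a : ℕ → ℝ} {x y d e : ℝ[X]} {N : ℕ}
    (hdeg : ∀ t ∈ Set.Icc (0 : ℝ) 1, (form m a (x + C t * d) (y + C t * e)).degree = N)
    (him : ∀ t ∈ Set.Icc (0 : ℝ) 1, ∀ z : ℂ, z.re = 0 →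
      aeval z (form m a (x + C t * d) (y + C t * e)) ≠ 0)
    (h0 : HurwitzStable (form m a x y)) :
    ∀ t ∈ Set.Icc (0 : ℝ) 1, HurwitzStable (form m a (x + C t * d) (y + C t * e)) := by
  have hlin : ∀ x d : ℝ[X], ∀ n, Continuous fun t : ℝ => (x + C t * d).coeff n := fun x d n => by
    simp only [coeff_add, coeff_C_mul]
    fun_prop
  have := stable_of_path (N := N)
    (Q := fun t => (form m a (x + C t * d) (y + C t * e)).map (algebraMap ℝ ℂ))
    (fun n => by
      simp only [coeff_map]
      exact Complex.continuous_ofReal.comp (continuous_coeff_form m a (hlin x d) (hlin y e) n))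
    (fun t ht => by rw [degree_map, hdeg t ht])
    (fun t ht z hz => by rw [eval_map_algebraMap]; exact him t ht z hz)
    (fun z hz => h0 z (by simpa [eval_map_algebraMap] using hz))
  intro t ht z hz
  exact this t ht z (by rw [eval_map_algebraMap]; exact hz)

/-- On the imaginary axis, the logarithmic derivative of an even or odd real polynomial is purely
imaginary. -/
lemma re_logDeriv_eq_zero_of_parity {D : ℝ[X]} (hD : D.comp (-X) = D ∨ D.comp (-X) = -D) {z : ℂ}
    (hz : z.re = 0) : (aeval z D.derivative / aeval z D).re = 0 := by
  -- On the imaginary axis conjugation is `z ↦ -z`.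
  have hconj : ∀ p : ℝ[X], (starRingEnd ℂ) (aeval z p) = aeval z (p.comp (-X)) := fun p => by
    rw [← Polynomial.aeval_conj, aeval_comp]
    congr 2
    apply Complex.ext <;> simp [hz]
  have hder : (D.comp (-X)).derivative = - D.derivative.comp (-X) := by
    rw [derivative_comp]; simp
  have key : (starRingEnd ℂ) (aeval z D.derivative / aeval z D) =
      -(aeval z D.derivative / aeval z D) := by
    rw [map_div₀, hconj, hconj, ← neg_neg (D.derivative.comp (-X)), ← hder]
    rcases hD with h | h <;> rw [h]
    · rw [map_neg, neg_div]
    · simp [div_neg]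
  have := congrArg Complex.re key
  rw [Complex.conj_re, Complex.neg_re] at this
  linarith

/-- The segment lemma: along a segment in the direction of an even or an odd polynomial, with
constant degree, stability of the end points implies stability. -/
lemma hurwitzStable_form_of_endpoints {m : ℕ} {a : ℕ → ℝ} {x y D : ℝ[X]} {c e : ℝ} {N : ℕ}
    (hD : D.comp (-X) = D ∨ D.comp (-X) = -D)
    (hdeg : ∀ t ∈ Set.Icc (0 : ℝ) 1,
      (form m a (x + C t * (C c * D)) (y + C t * (C e * D))).degree = N)
    (h0 : HurwitzStable (form m a x y))
    (h1 : HurwitzStable (form m a (x + C c * D) (y + C e * D))) :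
    ∀ t ∈ Set.Icc (0 : ℝ) 1,
      HurwitzStable (form m a (x + C t * (C c * D)) (y + C t * (C e * D))) := by
  refine hurwitzStable_form_segment hdeg (fun t ht z hz hroot => ?_) h0
  have hne : form m a (x + C t * (C c * D)) (y + C t * (C e * D)) ≠ 0 := fun h => by
    simpa [h] using hdeg t ht
  rw [aeval_form] at hroot
  obtain ⟨b, r, hbr, hfac, hlin⟩ :=
    exists_linear_factor (exists_coeff_ne_zero_of_form_ne_zero hne) hroot
  let ι := algebraMap ℝ ℂ
  -- Along the segment the linear factor is `g0 + t G`.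
  let g0 : ℂ[X] := C r * x.map ι - C b * y.map ι
  let G : ℂ[X] := C (r * c - b * e) * D.map ι
  have hg0eval : ∀ w, g0.eval w = r * aeval w x - b * aeval w y := fun w => by
    simp [g0, ι, eval_map_algebraMap]
  have hGeval : ∀ w, G.eval w = (r * c - b * e) * aeval w D := fun w => by
    simp [G, ι, eval_map_algebraMap]
  have hs0 : ∀ w, g0.eval w = 0 → w.re < 0 := fun w hw => h0 w <| by
    rw [aeval_form]
    exact formValue_eq_zero_of_linear_factor hbr hfac (by linear_combination hw - hg0eval w)
  have hs1 : ∀ w, (g0 + G).eval w = 0 → w.re < 0 := fun w hw => h1 w <| by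
    rw [aeval_form]
    refine formValue_eq_zero_of_linear_factor hbr hfac ?_
    rw [eval_add, hg0eval, hGeval] at hw
    simp only [map_add, map_mul, aeval_C, Complex.coe_algebraMap]
    linear_combination hw
  have hmix : g0.eval z + t * G.eval z = 0 := by
    rw [hg0eval, hGeval]
    simp only [map_add, map_mul, aeval_C, Complex.coe_algebraMap] at hlin
    linear_combination hlin
  have hz0 : g0.eval z ≠ 0 := fun h => by have := hs0 z h; linarith
  have hz1 : (g0 + G).eval z ≠ 0 := fun h => by have := hs1 z h; linarith
  have hGz : G.eval z ≠ 0 := fun h => hz0 (by simpa [h] using hmix)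
  have ht0 : t ≠ 0 := fun h => hz0 (by simpa [h] using hmix)
  have ht1 : t ≠ 1 := fun h => hz1 (by simpa [h] using hmix)
  have htpos : 0 < t := lt_of_le_of_ne ht.1 ht0.symm
  have htlt : 0 < 1 - t := sub_pos.2 (lt_of_le_of_ne ht.2 ht1)
  have hGlog : (G.derivative.eval z / G.eval z).re = 0 := by
    have hγ : (r * c - b * e : ℂ) ≠ 0 := fun h => hGz (by rw [hGeval, h, zero_mul])
    have : G.derivative.eval z = (r * c - b * e) * aeval z D.derivative := by
      simp [G, ι, derivative_map, eval_map_algebraMap]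
    rw [this, hGeval, mul_div_mul_left _ _ hγ]
    exact re_logDeriv_eq_zero_of_parity hD hz
  -- Since `g0 = -t G` and `g0 + G = (1 - t) G` at `z`, all three quotients have a common
  -- denominator.
  have hrel : ((1 - t : ℝ) : ℂ) * ((g0 + G).derivative.eval z / (g0 + G).eval z) =
      G.derivative.eval z / G.eval z - (t : ℂ) * (g0.derivative.eval z / g0.eval z) := by
    have e0 : g0.eval z = -t * G.eval z := by linear_combination hmix
    have e1 : (g0 + G).eval z = (1 - t : ℝ) * G.eval z := by
      rw [eval_add, e0]; push_cast; ring
    have htc : (t : ℂ) ≠ 0 := by exact_mod_cast ht0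
    have htc' : ((1 - t : ℝ) : ℂ) ≠ 0 := by exact_mod_cast htlt.ne'
    rw [e1, e0, derivative_add, eval_add]
    field_simp
    ring
  have hre := congrArg Complex.re hrel
  rw [Complex.re_ofReal_mul, Complex.sub_re, hGlog, Complex.re_ofReal_mul] at hre
  obtain ⟨n0, z0⟩ := re_logDeriv_nonneg hs0 hz
  obtain ⟨n1, z1⟩ := re_logDeriv_nonneg hs1 hz
  have p0 := mul_nonneg htpos.le n0
  have p1 := mul_nonneg htlt.le n1
  -- The real parts in `hrel` give two nonnegative terms with sum zero.
  have d0 : g0.natDegree = 0 :=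
    z0 ((mul_eq_zero.1 (by linarith : t * _ = 0)).resolve_left htpos.ne')
  have d1 : (g0 + G).natDegree = 0 :=
    z1 ((mul_eq_zero.1 (by linarith : (1 - t) * _ = 0)).resolve_left htlt.ne')
  have hconst0 : ∀ w, g0.eval w = g0.eval z := fun w => by
    rw [eq_C_of_natDegree_eq_zero d0, eval_C, eval_C]
  have hconst1 : ∀ w, (g0 + G).eval w = (g0 + G).eval z := fun w => by
    rw [eq_C_of_natDegree_eq_zero d1, eval_C, eval_C]
  -- The factor `g0 + t G` is constant and vanishes at `z`, hence everywhere, which forces the form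
  -- to be zero.
  refine hne (Polynomial.map_injective ι ι.injective ?_)
  rw [Polynomial.map_zero]
  refine Polynomial.funext fun w => ?_
  rw [eval_map_algebraMap, eval_zero, aeval_form]
  refine formValue_eq_zero_of_linear_factor hbr hfac ?_
  have hw : g0.eval w + t * G.eval w = 0 := by
    have hw0 := hconst0 w
    have hw1 := hconst1 w
    rw [eval_add, eval_add] at hw1
    linear_combination hmix + (1 - t) * hw0 + t * hw1
  rw [hg0eval, hGeval] at hw
  simp only [map_add, map_mul, aeval_C, Complex.coe_algebraMap]
  linear_combination hw

/-! ### Interval families and the Kharitonov parallelogram -/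

lemma mem_intervalFamily_iff {n : ℕ} {lo hi : ℕ → ℝ} {p : ℝ[X]} :
    p ∈ intervalFamily n lo hi ↔
      (∀ k ≤ n, p.coeff k ∈ Set.Icc (lo k) (hi k)) ∧ ∀ k, n < k → p.coeff k = 0 := by
  constructor
  · rintro ⟨q, hq, rfl⟩
    have hcoeff : ∀ k, (∑ i ∈ Finset.range (n + 1), C (q i) * X ^ i).coeff k =
        if k ≤ n then q k else 0 := fun k => by
      simp [finsetSum_coeff, coeff_X_pow]
    refine ⟨fun k hk => ?_, fun k hk => ?_⟩ <;> rw [hcoeff]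
    · rw [if_pos hk]; exact hq k hk
    · rw [if_neg (not_le.2 hk)]
  · rintro ⟨h1, h2⟩
    refine ⟨p.coeff, h1, ?_⟩
    simp only [C_mul_X_pow_eq_monomial]
    refine as_sum_range' p (n + 1) (Nat.lt_succ_of_le (natDegree_le_iff_coeff_eq_zero.2 ?_))
    exact fun k hk => h2 k hk

lemma add_mul_sub_mem_intervalFamily {n : ℕ} {lo hi : ℕ → ℝ} {p q : ℝ[X]}
    (hp : p ∈ intervalFamily n lo hi) (hq : q ∈ intervalFamily n lo hi) {t : ℝ}
    (ht : t ∈ Set.Icc (0 : ℝ) 1) : p + C t * (q - p) ∈ intervalFamily n lo hi := by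
  rw [mem_intervalFamily_iff] at *
  refine ⟨fun k hk => ?_, fun k hk => ?_⟩
  · rw [coeff_add, coeff_C_mul, coeff_sub]
    exact (convex_Icc (lo k) (hi k)).add_smul_sub_mem (hp.1 k hk) (hq.1 k hk) ht
  · rw [coeff_add, coeff_C_mul, coeff_sub, hp.2 k hk, hq.2 k hk]
    ring

lemma coeff_kharitonov (n : ℕ) (lo hi : ℕ → ℝ) (i : Fin 4) (k : ℕ) :
    (kharitonov n lo hi i).coeff k =
      if k ≤ n then (if k % 4 ∈ upperResidues i then hi k else lo k) else 0 := by
  simp [kharitonov, finsetSum_coeff, coeff_X_pow]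

lemma kharitonov_mem_intervalFamily {n : ℕ} {lo hi : ℕ → ℝ} (h : ∀ i ≤ n, lo i ≤ hi i)
    (i : Fin 4) : kharitonov n lo hi i ∈ intervalFamily n lo hi := by
  refine mem_intervalFamily_iff.2 ⟨fun k hk => ?_, fun k hk => ?_⟩ <;> rw [coeff_kharitonov]
  · rw [if_pos hk]
    split_ifs
    · exact ⟨h k hk, le_rfl⟩
    · exact ⟨le_rfl, h k hk⟩
  · rw [if_neg (not_le.2 hk)]

/-- Opposite corners of a parallelogram: numbers `0, 1` and numbers `2, 3` have complementary sign
patterns, so both pairs sum to `lo + hi`. -/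
lemma kharitonov_one_eq (n : ℕ) (lo hi : ℕ → ℝ) :
    kharitonov n lo hi 1 = kharitonov n lo hi 2 + kharitonov n lo hi 3 - kharitonov n lo hi 0 := by
  ext k
  simp only [coeff_add, coeff_sub, coeff_kharitonov]
  have hk : k % 4 < 4 := Nat.mod_lt _ (by norm_num)
  by_cases h : k ≤ n
  · interval_cases hr : k % 4 <;> simp [h, upperResidues]
  · simp [h]

/-- The direction in which the even part varies between the Kharitonov polynomials. -/
noncomputable def evenDirection (n : ℕ) (lo hi : ℕ → ℝ) : ℝ[X] :=
  kharitonov n lo hi 2 - kharitonov n lo hi 0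

/-- The direction in which the odd part varies between the Kharitonov polynomials. -/
noncomputable def oddDirection (n : ℕ) (lo hi : ℕ → ℝ) : ℝ[X] :=
  kharitonov n lo hi 3 - kharitonov n lo hi 0

lemma coeff_evenDirection (n : ℕ) (lo hi : ℕ → ℝ) (k : ℕ) :
    (evenDirection n lo hi).coeff k = if k ≤ n then
      (if k % 4 = 0 then hi k - lo k else if k % 4 = 2 then lo k - hi k else 0) else 0 := by
  rw [evenDirection, coeff_sub, coeff_kharitonov, coeff_kharitonov]
  have hk : k % 4 < 4 := Nat.mod_lt _ (by norm_num)
  by_cases h : k ≤ n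
  · interval_cases hr : k % 4 <;> simp [h, upperResidues]
  · simp [h]

lemma coeff_oddDirection (n : ℕ) (lo hi : ℕ → ℝ) (k : ℕ) :
    (oddDirection n lo hi).coeff k = if k ≤ n then
      (if k % 4 = 1 then hi k - lo k else if k % 4 = 3 then lo k - hi k else 0) else 0 := by
  rw [oddDirection, coeff_sub, coeff_kharitonov, coeff_kharitonov]
  have hk : k % 4 < 4 := Nat.mod_lt _ (by norm_num)
  by_cases h : k ≤ n
  · interval_cases hr : k % 4 <;> simp [h, upperResidues]
  · simp [h]

lemma coeff_comp_neg_X (p : ℝ[X]) (k : ℕ) : (p.comp (-X)).coeff k = p.coeff k * (-1) ^ k := by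
  rw [← comp_C_mul_X_coeff, C_neg, C_1, neg_one_mul]

lemma evenDirection_comp_neg_X (n : ℕ) (lo hi : ℕ → ℝ) :
    (evenDirection n lo hi).comp (-X) = evenDirection n lo hi := by
  ext k
  rw [coeff_comp_neg_X]
  rcases Nat.even_or_odd k with hk | hk
  · simp [hk.neg_one_pow]
  · have h1 : k % 4 ≠ 0 := by have := Nat.odd_iff.1 hk; omega
    have h2 : k % 4 ≠ 2 := by have := Nat.odd_iff.1 hk; omega
    simp [coeff_evenDirection, h1, h2]

lemma oddDirection_comp_neg_X (n : ℕ) (lo hi : ℕ → ℝ) :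
    (oddDirection n lo hi).comp (-X) = -oddDirection n lo hi := by
  ext k
  rw [coeff_comp_neg_X, coeff_neg]
  rcases Nat.even_or_odd k with hk | hk
  · have h1 : k % 4 ≠ 1 := by have := Nat.even_iff.1 hk; omega
    have h2 : k % 4 ≠ 3 := by have := Nat.even_iff.1 hk; omega
    simp [coeff_oddDirection, h1, h2]
  · simp [hk.neg_one_pow]

/-- The parallelogram spanned by the Kharitonov polynomials. -/
noncomputable def kharitonovBox (n : ℕ) (lo hi : ℕ → ℝ) (s t : ℝ) : ℝ[X] :=
  kharitonov n lo hi 0 + C s * evenDirection n lo hi + C t * oddDirection n lo hi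

lemma exists_kharitonovBox_eq_kharitonov (n : ℕ) (lo hi : ℕ → ℝ) {s t : ℝ} (hs : s = 0 ∨ s = 1)
    (ht : t = 0 ∨ t = 1) : ∃ i, kharitonovBox n lo hi s t = kharitonov n lo hi i := by
  rcases hs with rfl | rfl <;> rcases ht with rfl | rfl
  · exact ⟨0, by simp [kharitonovBox]⟩
  · exact ⟨3, by simp [kharitonovBox, oddDirection]⟩
  · exact ⟨2, by simp [kharitonovBox, evenDirection]⟩
  · refine ⟨1, ?_⟩
    rw [kharitonov_one_eq, kharitonovBox, evenDirection, oddDirection, C_1]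
    ring

lemma kharitonovBox_mem_intervalFamily {n : ℕ} {lo hi : ℕ → ℝ} (h : ∀ i ≤ n, lo i ≤ hi i)
    {s t : ℝ} (hs : s ∈ Set.Icc (0 : ℝ) 1) (ht : t ∈ Set.Icc (0 : ℝ) 1) :
    kharitonovBox n lo hi s t ∈ intervalFamily n lo hi := by
  have hK := kharitonov_mem_intervalFamily h
  -- Move by `s` along the two opposite even edges, then by `t` between the resulting points.
  convert add_mul_sub_mem_intervalFamily (add_mul_sub_mem_intervalFamily (hK 0) (hK 2) hs)
    (add_mul_sub_mem_intervalFamily (hK 3) (hK 1) hs) ht using 1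
  rw [kharitonov_one_eq, kharitonovBox, evenDirection, oddDirection]
  ring

/-! ### Value sets on the imaginary axis -/

lemma exists_mem_Icc_eq_mul {x y : ℝ} (h0 : 0 ≤ x) (h1 : x ≤ y) :
    ∃ s ∈ Set.Icc (0 : ℝ) 1, x = s * y := by
  rcases (h0.trans h1).eq_or_lt with hy | hy
  · exact ⟨0, by simp, by linarith⟩
  · exact ⟨x / y, ⟨div_nonneg h0 hy.le, (div_le_one hy).2 h1⟩, by field_simp⟩

/-- On the upper imaginary axis, the value of any member of an interval family is also taken by a
member of the parallelogram of Kharitonov polynomials. -/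
lemma exists_kharitonovBox_aeval_eq {n : ℕ} {lo hi : ℕ → ℝ} {p : ℝ[X]}
    (hp : p ∈ intervalFamily n lo hi) {w : ℝ} (hw : 0 ≤ w) :
    ∃ s ∈ Set.Icc (0 : ℝ) 1, ∃ t ∈ Set.Icc (0 : ℝ) 1,
      aeval (w * Complex.I) p = aeval (w * Complex.I) (kharitonovBox n lo hi s t) := by
  obtain ⟨hpI, hp0⟩ := mem_intervalFamily_iff.1 hp
  have hval : ∀ q : ℝ[X], (∀ k, n < k → q.coeff k = 0) → aeval (w * Complex.I) q =
      ∑ k ∈ Finset.range (n + 1), ((q.coeff k * w ^ k : ℝ) : ℂ) * Complex.I ^ (k % 4) := by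
    intro q hq
    rw [aeval_eq_sum_range' (n := n + 1)
      (Nat.lt_succ_of_le (natDegree_le_iff_coeff_eq_zero.2 fun k hk => hq k hk))]
    refine Finset.sum_congr rfl fun k _ => ?_
    rw [← Complex.I_pow_eq_pow_mod, Complex.real_smul, mul_pow]
    push_cast
    ring
  have hI3 : Complex.I ^ 3 = -Complex.I := Complex.I_pow_three
  set P := p - kharitonov n lo hi 0 with hP
  set E := evenDirection n lo hi with hE
  set D := oddDirection n lo hi with hD
  have hPval := hval P fun k hk => by
    rw [hP, coeff_sub, hp0 k hk, coeff_kharitonov, if_neg (not_le.2 hk), sub_zero]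
  have hEval := hval E fun k hk => by rw [coeff_evenDirection, if_neg (not_le.2 hk)]
  have hDval := hval D fun k hk => by rw [coeff_oddDirection, if_neg (not_le.2 hk)]
  -- Number `0` takes the lower bound where `I ^ k` is `1` or `I` and the upper bound where it is
  -- `-1` or `-I`, so it minimizes real and imaginary parts term by term. `E` and `D` carry the full
  -- ranges of the real and imaginary parts.
  have hterm : ∀ k ∈ Finset.range (n + 1),
      (0 ≤ (((P.coeff k * w ^ k : ℝ) : ℂ) * Complex.I ^ (k % 4)).re ∧
        (((P.coeff k * w ^ k : ℝ) : ℂ) * Complex.I ^ (k % 4)).re ≤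
          (((E.coeff k * w ^ k : ℝ) : ℂ) * Complex.I ^ (k % 4)).re) ∧
      (0 ≤ (((P.coeff k * w ^ k : ℝ) : ℂ) * Complex.I ^ (k % 4)).im ∧
        (((P.coeff k * w ^ k : ℝ) : ℂ) * Complex.I ^ (k % 4)).im ≤
          (((D.coeff k * w ^ k : ℝ) : ℂ) * Complex.I ^ (k % 4)).im) ∧
      (((E.coeff k * w ^ k : ℝ) : ℂ) * Complex.I ^ (k % 4)).im = 0 ∧
      (((D.coeff k * w ^ k : ℝ) : ℂ) * Complex.I ^ (k % 4)).re = 0 := by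
    intro k hk
    have hkn : k ≤ n := Nat.lt_succ_iff.1 (Finset.mem_range.1 hk)
    obtain ⟨hlo, hhi⟩ := hpI k hkn
    have hwk : 0 ≤ w ^ k := pow_nonneg hw k
    rw [hP, hE, hD, coeff_sub, coeff_evenDirection, coeff_oddDirection, coeff_kharitonov]
    simp only [if_pos hkn]
    have hk4 : k % 4 < 4 := Nat.mod_lt _ (by norm_num)
    rw [Complex.re_ofReal_mul, Complex.re_ofReal_mul, Complex.re_ofReal_mul,
      Complex.im_ofReal_mul, Complex.im_ofReal_mul, Complex.im_ofReal_mul]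
    interval_cases hr : k % 4 <;> simp [upperResidues, hI3] <;>
      refine ⟨by nlinarith, by nlinarith⟩
  obtain ⟨s, hs, hsE⟩ : ∃ s ∈ Set.Icc (0 : ℝ) 1,
      (aeval (w * Complex.I) P).re = s * (aeval (w * Complex.I) E).re := by
    rw [hPval, hEval, Complex.re_sum, Complex.re_sum]
    exact exists_mem_Icc_eq_mul (Finset.sum_nonneg fun k hk => (hterm k hk).1.1)
      (Finset.sum_le_sum fun k hk => (hterm k hk).1.2)
  obtain ⟨t, ht, htD⟩ : ∃ t ∈ Set.Icc (0 : ℝ) 1,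
      (aeval (w * Complex.I) P).im = t * (aeval (w * Complex.I) D).im := by
    rw [hPval, hDval, Complex.im_sum, Complex.im_sum]
    exact exists_mem_Icc_eq_mul (Finset.sum_nonneg fun k hk => (hterm k hk).2.1.1)
      (Finset.sum_le_sum fun k hk => (hterm k hk).2.1.2)
  have hEim : (aeval (w * Complex.I) E).im = 0 := by
    rw [hEval, Complex.im_sum]
    exact Finset.sum_eq_zero fun k hk => (hterm k hk).2.2.1
  have hDre : (aeval (w * Complex.I) D).re = 0 := by
    rw [hDval, Complex.re_sum]
    exact Finset.sum_eq_zero fun k hk => (hterm k hk).2.2.2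
  refine ⟨s, hs, t, ht, ?_⟩
  have hsplit : p = kharitonov n lo hi 0 + P := by rw [hP]; ring
  rw [hsplit, kharitonovBox, add_assoc, map_add, map_add]
  congr 1
  simp only [map_add, map_mul, aeval_C, Complex.coe_algebraMap]
  apply Complex.ext
  · rw [hsE, Complex.add_re, Complex.re_ofReal_mul, Complex.re_ofReal_mul, hDre]; ring
  · rw [htD, Complex.add_im, Complex.im_ofReal_mul, Complex.im_ofReal_mul, hEim]; ring

/-! ### From the corners to the parallelograms -/

/-- Stability of a form at the corners of two parallelograms of Kharitonov polynomials extends to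
the parallelograms. -/
lemma hurwitzStable_form_kharitonovBox {nu nv : ℕ} {lou hiu lov hiv : ℕ → ℝ}
    (hu : ∀ i ≤ nu, lou i ≤ hiu i) (hv : ∀ i ≤ nv, lov i ≤ hiv i) {m : ℕ} {a : ℕ → ℝ} {N : ℕ}
    (hdeg : ∀ x ∈ intervalFamily nu lou hiu, ∀ y ∈ intervalFamily nv lov hiv,
      (form m a x y).degree = N)
    (hK : ∀ i j, HurwitzStable (form m a (kharitonov nu lou hiu i) (kharitonov nv lov hiv j)))
    {s t s' t' : ℝ} (hs : s ∈ Set.Icc (0 : ℝ) 1) (ht : t ∈ Set.Icc (0 : ℝ) 1)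
    (hs' : s' ∈ Set.Icc (0 : ℝ) 1) (ht' : t' ∈ Set.Icc (0 : ℝ) 1) :
    HurwitzStable (form m a (kharitonovBox nu lou hiu s t) (kharitonovBox nv lov hiv s' t')) := by
  have hleft : ∀ x x' D y, (D.comp (-X) = D ∨ D.comp (-X) = -D) → x' = x + D →
      x ∈ intervalFamily nu lou hiu → x' ∈ intervalFamily nu lou hiu →
      y ∈ intervalFamily nv lov hiv → HurwitzStable (form m a x y) →
      HurwitzStable (form m a x' y) → ∀ r ∈ Set.Icc (0 : ℝ) 1,
      HurwitzStable (form m a (x + C r * D) y) := by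
    rintro x _ D y hD rfl hx hx' hy h0 h1 r hr
    have := hurwitzStable_form_of_endpoints (m := m) (a := a) (x := x) (y := y) (c := 1) (e := 0)
      (N := N) hD (fun r hr => by
        have hmem := add_mul_sub_mem_intervalFamily hx hx' hr
        rw [add_sub_cancel_left] at hmem
        simpa using hdeg _ hmem y hy) h0 (by simpa using h1) r hr
    simpa using this
  have hright : ∀ x y y' D, (D.comp (-X) = D ∨ D.comp (-X) = -D) → y' = y + D →
      x ∈ intervalFamily nu lou hiu → y ∈ intervalFamily nv lov hiv →
      y' ∈ intervalFamily nv lov hiv → HurwitzStable (form m a x y) →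
      HurwitzStable (form m a x y') → ∀ r ∈ Set.Icc (0 : ℝ) 1,
      HurwitzStable (form m a x (y + C r * D)) := by
    rintro x y _ D hD rfl hx hy hy' h0 h1 r hr
    have := hurwitzStable_form_of_endpoints (m := m) (a := a) (x := x) (y := y) (c := 0) (e := 1)
      (N := N) hD (fun r hr => by
        have hmem := add_mul_sub_mem_intervalFamily hy hy' hr
        rw [add_sub_cancel_left] at hmem
        simpa using hdeg x hx _ hmem) h0 (by simpa using h1) r hr
    simpa using this
  have heven : ∀ n lo hi s t, kharitonovBox n lo hi s t =
      kharitonovBox n lo hi 0 t + C s * evenDirection n lo hi := fun n lo hi s t => by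
    simp only [kharitonovBox, C_0]; ring
  have hodd : ∀ n lo hi s t, kharitonovBox n lo hi s t =
      kharitonovBox n lo hi s 0 + C t * oddDirection n lo hi := fun n lo hi s t => by
    simp only [kharitonovBox, C_0]; ring
  have heven1 : ∀ n lo hi t, kharitonovBox n lo hi 1 t =
      kharitonovBox n lo hi 0 t + evenDirection n lo hi := fun n lo hi t => by
    rw [heven, C_1, one_mul]
  have hodd1 : ∀ n lo hi s, kharitonovBox n lo hi s 1 =
      kharitonovBox n lo hi s 0 + oddDirection n lo hi := fun n lo hi s => by
    rw [hodd, C_1, one_mul]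
  have hE : ∀ n lo hi, (evenDirection n lo hi).comp (-X) = evenDirection n lo hi ∨
      (evenDirection n lo hi).comp (-X) = -evenDirection n lo hi := fun n lo hi =>
    Or.inl (evenDirection_comp_neg_X n lo hi)
  have hO : ∀ n lo hi, (oddDirection n lo hi).comp (-X) = oddDirection n lo hi ∨
      (oddDirection n lo hi).comp (-X) = -oddDirection n lo hi := fun n lo hi =>
    Or.inr (oddDirection_comp_neg_X n lo hi)
  have z0 : (0 : ℝ) ∈ Set.Icc (0 : ℝ) 1 := by simp
  have z1 : (1 : ℝ) ∈ Set.Icc (0 : ℝ) 1 := by simp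
  have hb : ∀ {r : ℝ}, r = 0 ∨ r = 1 → r ∈ Set.Icc (0 : ℝ) 1 := by
    rintro r (rfl | rfl) <;> simp
  have bu : ∀ {s t : ℝ}, s ∈ Set.Icc (0 : ℝ) 1 → t ∈ Set.Icc (0 : ℝ) 1 →
    kharitonovBox nu lou hiu s t ∈ intervalFamily nu lou hiu :=
    kharitonovBox_mem_intervalFamily hu
  have bv : ∀ {s t : ℝ}, s ∈ Set.Icc (0 : ℝ) 1 → t ∈ Set.Icc (0 : ℝ) 1 →
    kharitonovBox nv lov hiv s t ∈ intervalFamily nv lov hiv :=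
    kharitonovBox_mem_intervalFamily hv
  have corner : ∀ s t s' t' : ℝ, (s = 0 ∨ s = 1) → (t = 0 ∨ t = 1) → (s' = 0 ∨ s' = 1) →
      (t' = 0 ∨ t' = 1) →
      HurwitzStable (form m a (kharitonovBox nu lou hiu s t) (kharitonovBox nv lov hiv s' t')) := by
    intro s t s' t' hs ht hs' ht'
    obtain ⟨i, hi⟩ := exists_kharitonovBox_eq_kharitonov nu lou hiu hs ht
    obtain ⟨j, hj⟩ := exists_kharitonovBox_eq_kharitonov nv lov hiv hs' ht'
    rw [hi, hj]
    exact hK i j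
  -- The parameters are freed one at a time; each stage supplies the stable end points of the next.
  have vary_s : ∀ t s' t' : ℝ, (t = 0 ∨ t = 1) → (s' = 0 ∨ s' = 1) → (t' = 0 ∨ t' = 1) →
      HurwitzStable (form m a (kharitonovBox nu lou hiu s t) (kharitonovBox nv lov hiv s' t')) := by
    intro t s' t' ht hs' ht'
    rw [heven nu lou hiu s t]
    exact hleft _ _ _ _ (hE _ _ _) (heven1 _ _ _ _) (bu z0 (hb ht)) (bu z1 (hb ht))
      (bv (hb hs') (hb ht')) (corner _ _ _ _ (.inl rfl) ht hs' ht')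
      (corner _ _ _ _ (.inr rfl) ht hs' ht') s hs
  have vary_t : ∀ s' t' : ℝ, (s' = 0 ∨ s' = 1) → (t' = 0 ∨ t' = 1) →
      HurwitzStable (form m a (kharitonovBox nu lou hiu s t) (kharitonovBox nv lov hiv s' t')) := by
    intro s' t' hs' ht'
    rw [hodd nu lou hiu s t]
    exact hleft _ _ _ _ (hO _ _ _) (hodd1 _ _ _ _) (bu hs z0) (bu hs z1)
      (bv (hb hs') (hb ht')) (vary_s _ _ _ (.inl rfl) hs' ht') (vary_s _ _ _ (.inr rfl) hs' ht') t ht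
  have vary_s' : ∀ t' : ℝ, (t' = 0 ∨ t' = 1) →
      HurwitzStable (form m a (kharitonovBox nu lou hiu s t) (kharitonovBox nv lov hiv s' t')) := by
    intro t' ht'
    rw [heven nv lov hiv s' t']
    exact hright _ _ _ _ (hE _ _ _) (heven1 _ _ _ _) (bu hs ht) (bv z0 (hb ht')) (bv z1 (hb ht'))
      (vary_t _ _ (.inl rfl) ht') (vary_t _ _ (.inr rfl) ht') s' hs'
  rw [hodd nv lov hiv s' t']
  exact hright _ _ _ _ (hO _ _ _) (hodd1 _ _ _ _) (bu hs ht) (bv hs' z0) (bv hs' z1)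
    (vary_s' _ (.inl rfl)) (vary_s' _ (.inr rfl)) t' ht'

end RobustStability

/-! ### The sixteen-polynomial criterion -/

theorem theorem1 (nu nv : ℕ) (lou hiu lov hiv : ℕ → ℝ)
    (hu : ∀ i ≤ nu, lou i ≤ hiu i) (hv : ∀ i ≤ nv, lov i ≤ hiv i)
    (m : ℕ) (a : ℕ → ℝ)
    (hdeg : RobustStability.HasFixedDegree
      (RobustStability.imageFamily (RobustStability.form m a)
        (RobustStability.intervalFamily nu lou hiu)
        (RobustStability.intervalFamily nv lov hiv))) :
    RobustStability.FamilyHurwitzStable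
      (RobustStability.imageFamily (RobustStability.form m a)
        (RobustStability.intervalFamily nu lou hiu)
        (RobustStability.intervalFamily nv lov hiv)) ↔
    ∀ i j : Fin 4, RobustStability.HurwitzStable
      (RobustStability.form m a
        (RobustStability.kharitonov nu lou hiu i)
        (RobustStability.kharitonov nv lov hiv j)) := by
  have hKu := RobustStability.kharitonov_mem_intervalFamily hu
  have hKv := RobustStability.kharitonov_mem_intervalFamily hv
  refine ⟨fun h i j => h _ ⟨_, hKu i, _, hKv j, rfl⟩, fun hK => ?_⟩
  obtain ⟨N, hN⟩ := hdeg
  have hN' : ∀ x ∈ RobustStability.intervalFamily nu lou hiu,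
      ∀ y ∈ RobustStability.intervalFamily nv lov hiv,
      (RobustStability.form m a x y).degree = N := fun x hx y hy => hN _ ⟨x, hx, y, hy, rfl⟩
  have hupper : ∀ x ∈ RobustStability.intervalFamily nu lou hiu,
      ∀ y ∈ RobustStability.intervalFamily nv lov hiv, ∀ w : ℝ, 0 ≤ w →
      aeval (w * Complex.I) (RobustStability.form m a x y) ≠ 0 := by
    intro x hx y hy w hw h
    obtain ⟨s, hs, t, ht, hx'⟩ := RobustStability.exists_kharitonovBox_aeval_eq hx hw
    obtain ⟨s', hs', t', ht', hy'⟩ := RobustStability.exists_kharitonovBox_aeval_eq hy hw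
    rw [RobustStability.aeval_form, hx', hy', ← RobustStability.aeval_form] at h
    have := RobustStability.hurwitzStable_form_kharitonovBox hu hv hN' hK hs ht hs' ht' _ h
    simp at this
  have him : ∀ x ∈ RobustStability.intervalFamily nu lou hiu,
      ∀ y ∈ RobustStability.intervalFamily nv lov hiv, ∀ z : ℂ, z.re = 0 →
      aeval z (RobustStability.form m a x y) ≠ 0 := by
    intro x hx y hy z hz h
    rcases le_total 0 z.im with hi | hi
    · refine hupper x hx y hy z.im hi ?_
      have hz' : (z.im : ℂ) * Complex.I = z := by
        apply Complex.ext <;> simp [hz]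
      rw [hz', h]
    -- Real coefficients: the roots are symmetric under conjugation.
    · refine hupper x hx y hy (-z.im) (neg_nonneg.2 hi) ?_
      have hz' : ((-z.im : ℝ) : ℂ) * Complex.I = starRingEnd ℂ z := by
        apply Complex.ext <;> simp [hz]
      rw [hz', Polynomial.aeval_conj, h, map_zero]
  rintro _ ⟨x, hx, y, hy, rfl⟩
  have hx' := fun t ht => RobustStability.add_mul_sub_mem_intervalFamily (t := t) (hKu 0) hx ht
  have hy' := fun t ht => RobustStability.add_mul_sub_mem_intervalFamily (t := t) (hKv 0) hy ht
  -- Zero exclusion on the segment from the pair of Kharitonov polynomials number `0` to `(x, y)`.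
  have := RobustStability.hurwitzStable_form_segment (fun t ht => hN' _ (hx' t ht) _ (hy' t ht))
    (fun t ht => him _ (hx' t ht) _ (hy' t ht)) (hK 0 0) 1 (by simp)
  simpa using this
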